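/- Let $X$ be a separable metrizable topological space and let $C_b(X)$ be the space of bounded continuous real-valued functions on $X$, equipped with the strict topology $\beta$. Here $\beta$ is defined as follows. Let $\check X$ denote the Stone–Čech compactification of $X$, and for each compact set $Q\subseteq \check X\setminus X$ let $\beta_Q$ be the locally convex topology on $C_b(X)$ generated by the seminorms $f\mapsto \sup_{x\in X}|\varphi(x)f(x)|$, where $\varphi$ ranges over the functions in $C_b(X)$ whose continuous extension to $\check X$ vanishes on $Q$; then $\beta$ is the locally convex inductive limit of the topologies $\beta_Q$, i.e. the finest locally convex topology on $C_b(X)$ that is coarser than every $\beta_Q$. Then $(C_b(X),\beta)$ is transseparable: for every $\beta$-neighbourhood $U$ of $0$ there is a countable set $D\subseteq C_b(X)$ with $D+U=C_b(X)$. -/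

import Mathlib

open Set Topology
open scoped BoundedContinuousFunction Pointwise

/-- A topological additive group `(E, t)` (in particular, a locally convex space) is
transseparable if for every neighbourhood `U` of `0` countably many translates of `U`
cover `E`. -/
def IsTransseparable {E : Type*} [AddCommGroup E] (t : TopologicalSpace E) : Prop :=
  ∀ U ∈ @nhds E t 0, ∃ D : Set E, D.Countable ∧ D + U = univ

section Strict

variable {X : Type*} [TopologicalSpace X]

/-- Restriction to `X` of a continuous function on the Stone-Cech compactification of `X`.
For completely regular `X`, every bounded continuous function on `X` is of this form for a
unique `g`. -/
noncomputable def stoneCechRestrict (g : C(StoneCech X, ℝ)) : X →ᵇ ℝ :=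
  (BoundedContinuousFunction.mkOfCompact g).compContinuous
    ⟨stoneCechUnit, continuous_stoneCechUnit⟩

/-- The seminorm `f ↦ ‖φ f‖` (supremum norm over `X`) on `C_b(X)`, for a weight
`φ ∈ C_b(X)`. -/
noncomputable def weightSeminorm (φ : X →ᵇ ℝ) : Seminorm ℝ (X →ᵇ ℝ) :=
  (normSeminorm ℝ (X →ᵇ ℝ)).comp (LinearMap.mulLeft ℝ φ)

/-- The weights attached to a set `Q` in the Stone-Cech compactification: continuous functions
on the compactification which vanish on `Q`. -/
def StrictWeight (Q : Set (StoneCech X)) : Type _ :=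
  {g : C(StoneCech X, ℝ) // ∀ q ∈ Q, g q = 0}

instance (Q : Set (StoneCech X)) : Nonempty (StrictWeight Q) :=
  ⟨⟨0, fun _ _ => rfl⟩⟩

/-- The locally convex topology `β_Q` on `C_b(X)` generated by the seminorms `f ↦ ‖φ f‖`, where
`φ` runs through the bounded continuous functions on `X` whose extension to the Stone-Cech
compactification vanishes on `Q`. -/
noncomputable abbrev strictTopologyAt (Q : Set (StoneCech X)) : TopologicalSpace (X →ᵇ ℝ) :=
  SeminormFamily.moduleFilterBasis (𝕜 := ℝ)
    (fun g : StrictWeight Q => weightSeminorm (stoneCechRestrict g.1)) |>.topology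

variable (X) in
/-- The strict topology `β` on `C_b(X)`: the locally convex inductive limit of the topologies
`β_Q`, i.e. the finest locally convex vector space topology that is coarser than `β_Q` for every
compact subset `Q` of the Stone-Cech compactification that is disjoint from `X`.
(In the order on `TopologicalSpace`, `s ≤ t` says that `t` is coarser than `s`.) -/
noncomputable abbrev strictTopology : TopologicalSpace (X →ᵇ ℝ) :=
  sInf {t | @IsTopologicalAddGroup (X →ᵇ ℝ) t _ ∧ @ContinuousSMul ℝ (X →ᵇ ℝ) _ _ t ∧
    @LocallyConvexSpace ℝ (X →ᵇ ℝ) _ _ _ _ t ∧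
    ∀ Q : Set (StoneCech X), IsCompact Q → Disjoint Q (range (stoneCechUnit : X → StoneCech X)) →
      strictTopologyAt Q ≤ t}

end Strict

/-!
The strict topology `β` satisfies a Dini theorem: if a family of bounded continuous functions
decreases pointwise to `0`, then it converges to `0` for `β`. To see this, fix `ε > 0` and split
each `g ≥ 0` as `g = min g ε + (g - ε)⁺`. The first summand has norm at most `ε`. As for the second,
the set `Q` of points of the Stone-Cech compactification at which all extended functions are at
least `ε` is compact and misses `X`. A weight vanishing on `Q` is small off a compact set `C`
disjoint from `Q`, and by compactness of `C` the functions `(g - ε)⁺` eventually vanish on `C`;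
being uniformly bounded, they tend to `0` for `β_Q`. This is
`exists_finset_forall_mem_of_mem_nhds_strictTopologyAt`.

On a separable metrizable space there is a countable family of bounded continuous functions, namely
truncated cones with vertices in a countable dense set, such that every `f ∈ C_b(X)` is the
pointwise supremum of its minorants in the family. Closing it under binary suprema keeps it
countable and makes the minorants of `f` directed, so by the Dini theorem the resulting countable
set is even `β`-dense.
-/

section Countability

theorem Set.Countable.supClosure {α : Type*} [SemilatticeSup α] {s : Set α} (hs : s.Countable) :
    (_root_.supClosure s).Countable := by
  classical
  have := hs.to_subtype
  refine (countable_range fun t : {t : Finset s // t.Nonempty} =>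
    t.1.sup' t.2 (Subtype.val : s → α)).mono ?_
  rintro a ⟨t, ht, hts, rfl⟩
  refine ⟨⟨t.attach.image fun x => ⟨x.1, hts x.2⟩, by simpa using ht⟩, ?_⟩
  refine le_antisymm (Finset.sup'_le _ _ fun x hx => ?_) (Finset.sup'_le _ _ fun x hx => ?_)
  · obtain ⟨y, -, rfl⟩ := Finset.mem_image.1 hx
    exact Finset.le_sup' id y.2
  · exact Finset.le_sup' (Subtype.val : s → α) (b := ⟨x, hts hx⟩)
      (Finset.mem_image.2 ⟨⟨x, hx⟩, Finset.mem_attach _ _, rfl⟩)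

end Countability

/-! ### Countably many minorants -/

section Minorants

/-- The cone `x ↦ q - k * dist x p` with vertex `p`, height `q` and slope `k`, truncated from below
at `-m` so as to be bounded. -/
noncomputable def truncatedCone {X : Type*} [PseudoMetricSpace X] (p : X) (q : ℚ) (k m : ℕ) :
    X →ᵇ ℝ :=
  BoundedContinuousFunction.ofNormedAddCommGroup (fun x => max (-(m : ℝ)) (q - k * dist x p))
    (by fun_prop) (m + |(q : ℝ)|) (fun x => by
      have h1 : 0 ≤ k * dist x p := by positivity
      have h2 := le_abs_self (q : ℝ)
      have h3 := abs_nonneg (q : ℝ)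
      have h4 : (0 : ℝ) ≤ m := by positivity
      rw [Real.norm_eq_abs, abs_le]
      exact ⟨le_trans (by linarith) (le_max_left _ _), max_le (by linarith) (by linarith)⟩)

theorem truncatedCone_apply {X : Type*} [PseudoMetricSpace X] (p : X) (q : ℚ) (k m : ℕ) (x : X) :
    truncatedCone p q k m x = max (-(m : ℝ)) (q - k * dist x p) := rfl

/-- On a separable metrizable space, a single countable set of bounded continuous functions contains
enough minorants to recover every bounded continuous function as their pointwise supremum. -/
theorem exists_countable_forall_exists_le_sub_lt (X : Type*) [TopologicalSpace X]
    [TopologicalSpace.MetrizableSpace X] [TopologicalSpace.SeparableSpace X] :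
    ∃ B : Set (X →ᵇ ℝ), B.Countable ∧
      ∀ (f : X →ᵇ ℝ) (x : X) (ε : ℝ), 0 < ε → ∃ b ∈ B, b ≤ f ∧ f x - b x < ε := by
  let _ := TopologicalSpace.metrizableSpaceMetric X
  obtain ⟨P, hPc, hPd⟩ := TopologicalSpace.exists_countable_dense X
  have := hPc.to_subtype
  refine ⟨range fun i : P × ℚ × ℕ × ℕ => truncatedCone i.1.1 i.2.1 i.2.2.1 i.2.2.2,
    countable_range _, fun f x ε hε => ?_⟩
  obtain ⟨r, hr, hball⟩ := Metric.continuous_iff.1 f.continuous x (ε / 3) (by positivity)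
  obtain ⟨q, hq1, hq2⟩ := exists_rat_btwn (show f x - 2 * ε / 3 < f x - ε / 3 by linarith)
  obtain ⟨m, hm⟩ := exists_nat_gt ‖f‖
  -- The slope makes the cone drop from `q` to below `-m` within distance `r / 2` of its vertex.
  obtain ⟨k, hk⟩ := exists_nat_gt (((q : ℝ) + m) / (r / 2))
  have hk' : (q : ℝ) + m < k * (r / 2) := (div_lt_iff₀ (by positivity)).1 hk
  obtain ⟨p, hpP, hp⟩ := hPd.exists_dist_lt x
    (show 0 < min (r / 2) (ε / 3 / (k + 1)) by positivity)
  have hp1 := lt_of_lt_of_le hp (min_le_left _ _)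
  have hp2 : dist x p * (k + 1) < ε / 3 :=
    (lt_div_iff₀ (by positivity)).1 (lt_of_lt_of_le hp (min_le_right _ _))
  refine ⟨_, ⟨(⟨p, hpP⟩, q, k, m), rfl⟩, fun y => ?_, ?_⟩
  · change truncatedCone p q k m y ≤ f y
    rw [truncatedCone_apply]
    have hfy : -(m : ℝ) ≤ f y := by
      have := (abs_le.1 (f.norm_coe_le_norm y)).1
      linarith
    refine max_le hfy ?_
    by_cases hy : dist y p < r / 2
    · have hyx : dist y x < r := by
        have := dist_triangle_right y x p
        linarith
      have := (abs_lt.1 (hball y hyx)).1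
      have : 0 ≤ k * dist y p := by positivity
      linarith
    · have : k * (r / 2) ≤ k * dist y p :=
        mul_le_mul_of_nonneg_left (not_lt.1 hy) (Nat.cast_nonneg k)
      linarith
  · change f x - truncatedCone p q k m x < ε
    rw [truncatedCone_apply]
    have := le_max_right (-(m : ℝ)) (q - k * dist x p)
    have := dist_nonneg (x := x) (y := p)
    linarith

end Minorants

/-! ### Neighbourhoods of zero for the strict topology -/

section Neighbourhoods

variable {X : Type*} [TopologicalSpace X]

theorem weightSeminorm_stoneCechRestrict_le {g : C(StoneCech X, ℝ)} {h : X →ᵇ ℝ} {δ : ℝ}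
    (hδ : 0 ≤ δ) (H : ∀ x, |g (stoneCechUnit x)| * |h x| ≤ δ) :
    weightSeminorm (stoneCechRestrict g) h ≤ δ := by
  refine (BoundedContinuousFunction.norm_le hδ).2 fun x => ?_
  rw [Real.norm_eq_abs]
  exact (abs_mul _ _).trans_le (H x)

theorem exists_finset_forall_of_mem_nhds_strictTopologyAt {Q : Set (StoneCech X)}
    {V : Set (X →ᵇ ℝ)} (hV : V ∈ @nhds _ (strictTopologyAt Q) 0) :
    ∃ (s : Finset (StrictWeight Q)) (δ : ℝ), 0 < δ ∧ ∀ h : X →ᵇ ℝ,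
      (∀ w ∈ s, ∀ x, |w.1 (stoneCechUnit x)| * |h x| ≤ δ) → h ∈ V := by
  obtain ⟨W, hW, hWV⟩ := (AddGroupFilterBasis.nhds_zero_hasBasis _).mem_iff.1 hV
  obtain ⟨s, r, hr, rfl⟩ := (SeminormFamily.basisSets_iff _).1 hW
  refine ⟨s, r / 2, by positivity, fun h hh => hWV ?_⟩
  rw [id, Seminorm.mem_ball_zero]
  refine Seminorm.finset_sup_apply_lt hr fun w hw => ?_
  exact (weightSeminorm_stoneCechRestrict_le (by positivity) (hh w hw)).trans_lt (half_lt_self hr)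

/-- Each `β_Q` is coarser than the norm topology. -/
theorem exists_forall_abs_le_mem_of_mem_nhds_strictTopologyAt {Q : Set (StoneCech X)}
    {V : Set (X →ᵇ ℝ)} (hV : V ∈ @nhds _ (strictTopologyAt Q) 0) :
    ∃ ε : ℝ, 0 < ε ∧ ∀ h : X →ᵇ ℝ, (∀ x, |h x| ≤ ε) → h ∈ V := by
  obtain ⟨s, δ, hδ, hs⟩ := exists_finset_forall_of_mem_nhds_strictTopologyAt hV
  set M : ℝ := ∑ w ∈ s, ‖w.1‖ with hM
  have hM0 : 0 ≤ M := Finset.sum_nonneg fun _ _ => norm_nonneg _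
  refine ⟨δ / (M + 1), by positivity, fun h hh => hs h fun w hw x => ?_⟩
  have h1 : |w.1 (stoneCechUnit x)| ≤ M + 1 :=
    ((w.1.norm_coe_le_norm _).trans
      (Finset.single_le_sum (f := fun w : StrictWeight Q => ‖w.1‖)
        (fun _ _ => norm_nonneg _) hw)).trans (by linarith)
  calc |w.1 (stoneCechUnit x)| * |h x| ≤ (M + 1) * (δ / (M + 1)) :=
        mul_le_mul h1 (hh x) (abs_nonneg _) (by positivity)
    _ = δ := by field_simp

theorem exists_continuousMap_stoneCech_extension (f : X →ᵇ ℝ) :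
    ∃ F : C(StoneCech X, ℝ), ∀ x, F (stoneCechUnit x) = f x := by
  have hf : Continuous fun x => (⟨f x, mem_closedBall_zero_iff.2 (f.norm_coe_le_norm x)⟩ :
      Metric.closedBall (0 : ℝ) ‖f‖) := by fun_prop
  have : CompactSpace (Metric.closedBall (0 : ℝ) ‖f‖) :=
    isCompact_iff_compactSpace.1 (isCompact_closedBall _ _)
  exact ⟨⟨fun y => (stoneCechExtend hf y).1,
    continuous_subtype_val.comp (continuous_stoneCechExtend hf)⟩,
    fun x => congrArg Subtype.val (stoneCechExtend_stoneCechUnit hf x)⟩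

/-- The Dini property of the strict topology. If the functions in `G` get below `ε` at every point
of `X`, then any set `V` which is a neighbourhood of `0` for all `β_Q` admits finitely many
`g ∈ G` such that `V` contains all functions bounded by `M` which vanish wherever one of these `g`
is below `ε`. -/
theorem exists_finset_forall_mem_of_mem_nhds_strictTopologyAt {V : Set (X →ᵇ ℝ)}
    (hV : ∀ Q : Set (StoneCech X), IsCompact Q →
      Disjoint Q (range (stoneCechUnit : X → StoneCech X)) → V ∈ @nhds _ (strictTopologyAt Q) 0)
    {G : Set (X →ᵇ ℝ)} {ε : ℝ} (hG : ∀ x, ∃ g ∈ G, g x < ε) (M : ℝ) :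
    ∃ t : Finset (X →ᵇ ℝ), ↑t ⊆ G ∧ ∀ h : X →ᵇ ℝ, (∀ x, |h x| ≤ M) →
      (∀ x, (∃ g ∈ t, g x < ε) → h x = 0) → h ∈ V := by
  choose E hE using exists_continuousMap_stoneCech_extension (X := X)
  set Q : Set (StoneCech X) := ⋂ g ∈ G, {y | ε ≤ E g y} with hQ
  have hQc : IsCompact Q :=
    (isClosed_biInter fun g _ => isClosed_le continuous_const (E g).continuous).isCompact
  have hQX : Disjoint Q (range (stoneCechUnit : X → StoneCech X)) := by
    rw [disjoint_right]
    rintro _ ⟨x, rfl⟩ hx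
    obtain ⟨g, hg, hgx⟩ := hG x
    have : ε ≤ E g (stoneCechUnit x) := mem_iInter₂.1 hx g hg
    rw [hE] at this
    linarith
  obtain ⟨s, δ, hδ, hs⟩ := exists_finset_forall_of_mem_nhds_strictTopologyAt (hV Q hQc hQX)
  -- Off `C`, functions bounded by `M` satisfy the constraints imposed by the weights in `s`.
  set C : Set (StoneCech X) := ⋃ w ∈ s, {y | δ ≤ |w.1 y| * M} with hC
  have hCc : IsCompact C := by
    refine (isClosed_biUnion_finset fun w _ => isClosed_le continuous_const ?_).isCompact
    exact (w.1.continuous.abs).mul continuous_const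
  have hCG : C ⊆ ⋃ g ∈ G, {y | E g y < ε} := by
    intro y hy
    obtain ⟨w, -, hwy⟩ := mem_iUnion₂.1 hy
    by_contra hy'
    have hyQ : y ∈ Q := by
      simpa [hQ] using hy'
    have hwy' : δ ≤ |w.1 y| * M := hwy
    rw [w.2 y hyQ, abs_zero, zero_mul] at hwy'
    linarith
  obtain ⟨t, htG, htf, hCt⟩ := hCc.elim_finite_subcover_image
    (fun g _ => isOpen_lt (E g).continuous continuous_const) hCG
  refine ⟨htf.toFinset, by simpa using htG, fun h hhM hh0 => hs h fun w hw x => ?_⟩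
  by_cases hx : stoneCechUnit x ∈ C
  · obtain ⟨g, hg, hgx⟩ := mem_iUnion₂.1 (hCt hx)
    have hgx' : E g (stoneCechUnit x) < ε := hgx
    rw [hE] at hgx'
    rw [hh0 x ⟨g, htf.mem_toFinset.2 hg, hgx'⟩, abs_zero, mul_zero]
    exact hδ.le
  · have hlt : |w.1 (stoneCechUnit x)| * M < δ :=
      not_le.1 fun h' => hx (mem_iUnion₂.2 ⟨w, hw, h'⟩)
    exact (mul_le_mul_of_nonneg_left (hhM x) (abs_nonneg _)).trans hlt.le

/-- If `f` is the pointwise supremum of its minorants in the sup-closed set `D`, then `f` lies in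
the closure of `D` for the strict topology. -/
theorem exists_mem_sub_mem_add_of_mem_nhds_strictTopologyAt [Nonempty X] {V : Set (X →ᵇ ℝ)}
    (hV : ∀ Q : Set (StoneCech X), IsCompact Q →
      Disjoint Q (range (stoneCechUnit : X → StoneCech X)) → V ∈ @nhds _ (strictTopologyAt Q) 0)
    {D : Set (X →ᵇ ℝ)} (hD : SupClosed D) {f : X →ᵇ ℝ}
    (hf : ∀ (x : X) (ε : ℝ), 0 < ε → ∃ b ∈ D, b ≤ f ∧ f x - b x < ε) :
    ∃ a ∈ D, f - a ∈ V + V := by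
  classical
  obtain ⟨ε, hε, hεV⟩ := exists_forall_abs_le_mem_of_mem_nhds_strictTopologyAt
    (hV ∅ isCompact_empty (empty_disjoint _))
  -- Any minorant `b₀` in `D` serves to bound uniformly the differences `f - a` with `b₀ ≤ a ≤ f`.
  obtain ⟨b₀, hb₀D, hb₀f, -⟩ := hf (Classical.arbitrary X) 1 one_pos
  obtain ⟨t, ht, htV⟩ := exists_finset_forall_mem_of_mem_nhds_strictTopologyAt hV
    (G := (fun b => f - b) '' {b ∈ D | b ≤ f}) (ε := ε)
    (fun x => by
      obtain ⟨b, hbD, hbf, hbx⟩ := hf x ε hε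
      exact ⟨f - b, ⟨b, ⟨hbD, hbf⟩, rfl⟩, hbx⟩) ‖f - b₀‖
  have htD : ∀ g ∈ t, f - g ∈ D ∧ f - g ≤ f := by
    intro g hg
    obtain ⟨b, hb, rfl⟩ := ht hg
    simpa using hb
  set u : Finset (X →ᵇ ℝ) := insert b₀ (t.image fun g => f - g) with hu
  have hu' : ∀ b ∈ u, b ∈ D ∧ b ≤ f := by
    intro b hb
    rcases Finset.mem_insert.1 hb with rfl | hb
    · exact ⟨hb₀D, hb₀f⟩
    · obtain ⟨g, hg, rfl⟩ := Finset.mem_image.1 hb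
      exact htD g hg
  have hune : u.Nonempty := Finset.insert_nonempty _ _
  set a := u.sup' hune id with ha
  have haD : a ∈ D := hD.finsetSup'_mem hune fun b hb => (hu' b hb).1
  have haf : ∀ x, a x ≤ f x := Finset.sup'_le hune id fun b hb => (hu' b hb).2
  have hba : ∀ b ∈ u, ∀ x, b x ≤ a x := fun b hb => Finset.le_sup' id hb
  let c : X →ᵇ ℝ := BoundedContinuousFunction.const X ε
  refine ⟨a, haD, (f - a) ⊓ c, hεV _ fun x => ?_, (f - a) - (f - a) ⊓ c,
    htV _ (fun x => ?_) ?_, add_sub_cancel _ _⟩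
  · change |min (f x - a x) ε| ≤ ε
    rw [abs_of_nonneg (le_min (sub_nonneg.2 (haf x)) hε.le)]
    exact min_le_right _ _
  · change |(f x - a x) - min (f x - a x) ε| ≤ _
    have h1 : 0 ≤ min (f x - a x) ε := le_min (sub_nonneg.2 (haf x)) hε.le
    have h2 := min_le_left (f x - a x) ε
    have h3 := hba b₀ (Finset.mem_insert_self _ _) x
    have h4 : f x - b₀ x ≤ ‖f - b₀‖ := (le_abs_self _).trans ((f - b₀).norm_coe_le_norm x)
    rw [abs_of_nonneg (by linarith)]
    linarith
  · rintro x ⟨g, hg, hgx⟩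
    change (f x - a x) - min (f x - a x) ε = 0
    have h1 : f x - g x ≤ a x :=
      hba (f - g) (Finset.mem_insert_of_mem (Finset.mem_image_of_mem _ hg)) x
    rw [min_eq_left (by linarith), sub_self]

end Neighbourhoods

theorem lemma1p8 {X : Type*} [TopologicalSpace X] [TopologicalSpace.MetrizableSpace X]
    [TopologicalSpace.SeparableSpace X] :
    IsTransseparable (strictTopology X) := by
  intro U hU
  rcases isEmpty_or_nonempty X with hX | hX
  · refine ⟨{0}, countable_singleton 0, eq_univ_of_forall fun f => ?_⟩
    exact ⟨0, rfl, 0, @mem_of_mem_nhds _ (strictTopology X) _ _ hU,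
      BoundedContinuousFunction.ext fun x => hX.elim x⟩
  have hgrp : @IsTopologicalAddGroup (X →ᵇ ℝ) (strictTopology X) _ :=
    topologicalAddGroup_sInf fun _ ht => ht.1
  obtain ⟨V, hV, hVU⟩ := @exists_nhds_zero_half _ (strictTopology X) _ hgrp.toContinuousAdd _ hU
  have hVQ : ∀ Q : Set (StoneCech X), IsCompact Q →
      Disjoint Q (range (stoneCechUnit : X → StoneCech X)) →
      V ∈ @nhds _ (strictTopologyAt Q) 0 := fun Q hQ hQX =>
    nhds_mono (le_sInf fun _ ht => ht.2.2.2 Q hQ hQX) hV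
  obtain ⟨B, hBc, hB⟩ := exists_countable_forall_exists_le_sub_lt X
  refine ⟨supClosure B, hBc.supClosure, eq_univ_of_forall fun f => ?_⟩
  obtain ⟨a, haD, v, hv, w, hw, hvw⟩ := exists_mem_sub_mem_add_of_mem_nhds_strictTopologyAt hVQ
    supClosed_supClosure (f := f) fun x ε hε => by
      obtain ⟨b, hb, h⟩ := hB f x ε hε
      exact ⟨b, subset_supClosure hb, h⟩
  exact ⟨a, haD, v + w, hVU v hv w hw, by
    rw [show v + w = f - a from hvw]
    exact add_sub_cancel a f⟩
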